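/- Let $B$ be a positive integer (the bin size) and let $F$ be a distribution on item sizes: there are finitely many types $j=1,\dots,J$ with integer sizes $0<s_1<\dots<s_J<B$ and probabilities $p_j\ge 0$, $\sum_j p_j=1$. Items with i.i.d. types drawn from $F$ arrive one at a time and are packed on arrival into bins of size $B$, of which there is an unlimited supply. The level of a bin is the total size of its items. Let $N_h(t)$, $1\le h\le B-1$, be the number of bins of level $h$ after $t$ arrivals (with $N_h(0)=0$ for all $h$), and let the waste after $n$ arrivals be $W(n)=\sum_{h=1}^{B-1}(B-h)N_h(n)$. The algorithm PD-exp with parameter $\epsilon>0$ works as follows: when the $t$-th item arrives, say of size $s$, it is sent to a bin of level $h^*$, where $h^*$ minimizes $$B\cdot\mathbf 1_{\{h=0\}}-s+\frac{B}{\epsilon}\sum_{k=1}^{B-1}e^{-\epsilon N_k(t)}$$ over all levels $0\le h\le B-s$ such that $h=0$ (a new bin is opened) or $N_h(t-1)>0$. Here $N_k(t)$ denotes the counts resulting from sending the item to level $h$: the count at level $h$ drops by one and the count at level $h+s$ rises by one, where only levels $1,\dots,B-1$ are counted. Ties are broken arbitrarily, possibly at random and depending on the past, but not on future arrivals. Let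 $n>B$ and run PD-exp with the fixed parameter $\epsilon=\sqrt{B/n}$. Let $W_F^{\text{PD-exp}}(n)$ be its waste after $n$ arrivals, and let $W_F^{OPT}(n)$ be the minimum waste over all offline packings of the same $n$ items into bins of size $B$. Then, for every such $F$, $$\mathbb E\big[W_F^{\text{PD-exp}}(n)\big]\le \mathbb E\big[W_F^{OPT}(n)\big]+\sqrt{4B^3n}.$$ -/

import Mathlib

open MeasureTheory ProbabilityTheory

noncomputable section

namespace BinPacking

/-- Total unused space in the partially filled bins, when `N h` bins have level (total content) `h`
for each `1 ≤ h ≤ B - 1`. -/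
def waste (B : ℕ) (N : ℕ → ℕ) : ℕ :=
  ∑ h ∈ Finset.Icc 1 (B - 1), N h * (B - h)

/-! ### Offline packings of a list of items -/

/-- Level of the bin `b` when item `i`, of size `a i`, is put into bin `f i`. -/
def binLevel {n : ℕ} (a : Fin n → ℕ) (f : Fin n → ℕ) (b : ℕ) : ℕ :=
  ∑ i ∈ Finset.univ.filter (fun i => f i = b), a i

/-- The assignment `f` of items to bins respects the bin size `B`. -/
def IsPacking {n : ℕ} (B : ℕ) (a : Fin n → ℕ) (f : Fin n → ℕ) : Prop :=
  ∀ b, binLevel a f b ≤ B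

/-- The number of used bins of level `h` under the assignment `f`. -/
def levelCount {n : ℕ} (a : Fin n → ℕ) (f : Fin n → ℕ) (h : ℕ) : ℕ :=
  ((Finset.univ.image f).filter (fun b => binLevel a f b = h)).card

/-- The waste of an optimal offline packing of the items with sizes `a` into bins of size `B`. -/
def optWaste {n : ℕ} (B : ℕ) (a : Fin n → ℕ) : ℕ :=
  sInf {w | ∃ f : Fin n → ℕ, IsPacking B a f ∧ w = waste B (levelCount a f)}

/-! ### The algorithm PD-exp -/

/-- An item of size `s` can be sent to a bin of level `h`: it fits, and either a new bin is opened
(`h = 0`) or a bin of level `h` is present. -/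
def Feasible (B : ℕ) (N : ℕ → ℕ) (s h : ℕ) : Prop :=
  h + s ≤ B ∧ (h = 0 ∨ 0 < N h)

/-- The state after an item of size `s` has been sent to a bin of level `h`.
Only the levels `1, …, B - 1` are counted (`N 0 = N B = 0` by convention). -/
def place (B : ℕ) (N : ℕ → ℕ) (s h : ℕ) : ℕ → ℕ := fun k =>
  if 1 ≤ k ∧ k ≤ B - 1 then
    N k + (if k = h + s then 1 else 0) - (if k = h then 1 else 0)
  else 0

/-- The quantity that PD-exp minimizes: the increase of the primal objective
`∑ (B - h) N_h` caused by sending an item of size `s` to level `h`, plus the exponential penalty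
of the state after packing. -/
def objective (B : ℕ) (ε : ℝ) (N : ℕ → ℕ) (s h : ℕ) : ℝ :=
  (if h = 0 then (B : ℝ) else 0) - (s : ℝ)
    + (B : ℝ) / ε * ∑ k ∈ Finset.Icc 1 (B - 1), Real.exp (-ε * (place B N s h k : ℝ))

/-- One step of PD-exp: `N'` is the state after an arriving item of size `s` has been sent to a
feasible level minimizing the objective (any minimizer may be used). -/
def PDExpStep (B : ℕ) (ε : ℝ) (s : ℕ) (N N' : ℕ → ℕ) : Prop :=
  ∃ h, Feasible B N s h ∧
    (∀ h', Feasible B N s h' → objective B ε N s h ≤ objective B ε N s h') ∧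
    N' = place B N s h

/-- The item types `X 0, …, X (n - 1)` are i.i.d. with `P (X t = j) = p j`: each `X t` is known
from time `t + 1` on and is independent of the past `ℱ t`
(which contains `X 0, …, X (t - 1)` and possibly the randomness of an algorithm up to then). -/
structure IsIIDArrivals {Ω : Type*} [mΩ : MeasurableSpace Ω] (P : Measure Ω)
    (ℱ : Filtration ℕ mΩ) {J : ℕ} (p : Fin J → ℝ) (n : ℕ) (X : ℕ → Ω → Fin J) : Prop where
  measurable : ∀ t < n, Measurable[ℱ (t + 1)] (X t)
  law : ∀ t < n, ∀ j, P.real {ω | X t ω = j} = p j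
  indep : ∀ t < n, Indep (MeasurableSpace.comap (X t) ⊤) (ℱ t) P

/-- `N t ω h` is the number of bins of level `h` after PD-exp with parameter `ε` has packed the
first `t` arrivals, starting from no bins; arrival `t` has size `s (X t ω)`. Ties in the choice of
the level are broken in any, possibly randomized, non-anticipating way. -/
structure IsPDExp {Ω : Type*} [mΩ : MeasurableSpace Ω] (P : Measure Ω)
    (ℱ : Filtration ℕ mΩ) (B : ℕ) (ε : ℝ) {J : ℕ} (s : Fin J → ℕ) (n : ℕ)
    (X : ℕ → Ω → Fin J) (N : ℕ → Ω → ℕ → ℕ) : Prop where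
  adapted : ∀ t ≤ n, ∀ h, Measurable[ℱ t] (fun ω => N t ω h)
  init : ∀ᵐ ω ∂P, ∀ h, N 0 ω h = 0
  step : ∀ᵐ ω ∂P, ∀ t < n, PDExpStep B ε (s (X t ω)) (N t ω) (N (t + 1) ω)

end BinPacking

end

/-!
The waste of PD-exp is controlled through the potential
`V = waste + (B / ε) * ∑ k, exp (-ε * N k)`. The objective which PD-exp minimizes is, up to a
constant, the increase of `V`, so in each step `V` rises by the least possible amount
`minIncrease B ε N s` (`potential_of_step`).

The main point (`sum_minIncrease_le_optWaste`) is deterministic: if the state `N` is held *fixed*,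
the least increases of the items of any list sum to at most the optimal offline waste of the list
plus `B * ε` per item. To see this, take the items of one offline bin one after the other, moving
from level `0` up to the level `L` of that bin. Moving an item of size `s` from level `h` to `h + s`
changes `V` by `-s`, plus `B` if a new bin is opened, plus the penalty lost at `h`, minus the one
gained at `h + s`. Along the path these penalty terms telescope, with an error of at most `B * ε`
per item (`exp_mul_gain_le`), and leave at most `B - L`. A level `h` at which there is no bin cannot
be used, but the item can open a new bin there: the penalty term collected at `h` is almost `B`
(`le_gain_of_eq_zero`) and pays for it.

Applied to the random arrivals with a fixed state and integrated, this bounds the expected least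
increase for one random item by `E[OPT] / n + B * ε`, in every state (`expected_minIncrease_le`).
Since each arrival is independent of the current state, this bounds the expected growth of `V` in
each step (`integral_potential_le`). Starting from `V ≤ B ^ 2 / ε`, the expected potential, and hence
the expected waste, is at most `E[OPT] + B ^ 2 / ε + n * B * ε`; the two error terms are equal for
`ε = √(B / n)`.
-/

noncomputable section

namespace BinPacking

/-! ### The potential and its least increase -/

/-- The exponential penalty of a state; the last summand of `objective` is the penalty of the state
after packing. -/
def penalty (B : ℕ) (ε : ℝ) (N : ℕ → ℕ) : ℝ :=
  (B : ℝ) / ε * ∑ k ∈ Finset.Icc 1 (B - 1), Real.exp (-ε * (N k : ℝ))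

/-- The potential: waste plus exponential penalty. -/
def potential (B : ℕ) (ε : ℝ) (N : ℕ → ℕ) : ℝ :=
  (waste B N : ℝ) + penalty B ε N

/-- The smallest increase of the potential that packing an item of size `s` in state `N` can
cause. For `0 < ε` and `s ≤ B` the infimum is that of a nonempty set bounded below by `-s`. -/
def minIncrease (B : ℕ) (ε : ℝ) (N : ℕ → ℕ) (s : ℕ) : ℝ :=
  sInf (objective B ε N s '' {h | Feasible B N s h}) - penalty B ε N

/-- The decrease of the penalty when the number of bins of level `k` rises by one; it vanishes at
the levels `0` and `B`, which are not counted. -/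
def gain (B : ℕ) (ε : ℝ) (N : ℕ → ℕ) (k : ℕ) : ℝ :=
  if 1 ≤ k ∧ k ≤ B - 1 then (B : ℝ) / ε * (Real.exp (-ε * (N k : ℝ)) * (1 - Real.exp (-ε))) else 0

section Deterministic

variable {B : ℕ} {ε : ℝ} {N : ℕ → ℕ} {s h : ℕ}

lemma cast_place (hf : Feasible B N s h) {k : ℕ} (hk : k ∈ Finset.Icc 1 (B - 1)) :
    (place B N s h k : ℝ) = N k + (if k = h + s then 1 else 0) - (if k = h then 1 else 0) := by
  rw [Finset.mem_Icc] at hk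
  rw [place, if_pos hk, Nat.cast_sub]
  · push_cast; rfl
  · split_ifs with h1 h2 h2
    · omega
    · subst h1
      rcases hf.2 with h0 | h0 <;> omega
    · omega
    · omega

lemma waste_place (hs : 0 < s) (hf : Feasible B N s h) :
    (waste B (place B N s h) : ℝ) = waste B N + ((if h = 0 then (B : ℝ) else 0) - s) := by
  have hB : h + s ≤ B := hf.1
  have key : ∀ M : ℕ → ℕ, (waste B M : ℝ)
      = ∑ k ∈ Finset.Icc 1 (B - 1), (M k : ℝ) * ((B : ℝ) - k) := by
    intro M
    rw [waste, Nat.cast_sum]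
    refine Finset.sum_congr rfl fun k hk => ?_
    rw [Finset.mem_Icc] at hk
    rw [Nat.cast_mul, Nat.cast_sub (by omega)]
  have hsplit : ∀ k ∈ Finset.Icc 1 (B - 1), (place B N s h k : ℝ) * ((B : ℝ) - k)
      = (N k : ℝ) * ((B : ℝ) - k) + ((if k = h + s then (B : ℝ) - k else 0)
        - (if k = h then (B : ℝ) - k else 0)) := by
    intro k hk
    rw [cast_place hf hk]
    split_ifs <;> ring
  rw [key, key, Finset.sum_congr rfl hsplit, Finset.sum_add_distrib, Finset.sum_sub_distrib,
    Finset.sum_ite_eq', Finset.sum_ite_eq']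
  simp only [Finset.mem_Icc]
  have h1 : (if 1 ≤ h + s ∧ h + s ≤ B - 1 then (B : ℝ) - ((h + s : ℕ) : ℝ) else 0)
      = (B : ℝ) - h - s := by
    split_ifs with hc
    · push_cast; ring
    · have : h + s = B := by omega
      rw [← this]; push_cast; ring
  rw [h1]
  split_ifs with h2 h3 h3
  · omega
  · ring
  · subst h3; simp
  · omega

lemma penalty_place (hs : 0 < s) (hf : Feasible B N s h) :
    penalty B ε (place B N s h) = penalty B ε N - gain B ε N (h + s)
      + Real.exp ε * gain B ε N h := by
  have hsplit : ∀ k ∈ Finset.Icc 1 (B - 1), Real.exp (-ε * (place B N s h k : ℝ))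
      = Real.exp (-ε * (N k : ℝ))
        - (if k = h + s then Real.exp (-ε * (N k : ℝ)) * (1 - Real.exp (-ε)) else 0)
        + (if k = h then Real.exp ε * (Real.exp (-ε * (N k : ℝ)) * (1 - Real.exp (-ε))) else 0) := by
    intro k hk
    rw [cast_place hf hk]
    have e : Real.exp ε * Real.exp (-ε) = 1 := by rw [← Real.exp_add]; simp
    split_ifs with h1 h2 h2
    · omega
    · rw [show -ε * ((N k : ℝ) + 1 - 0) = -ε * (N k : ℝ) + -ε by ring, Real.exp_add]
      ring
    · rw [show -ε * ((N k : ℝ) + 0 - 1) = -ε * (N k : ℝ) + ε by ring, Real.exp_add]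
      linear_combination (Real.exp (-ε * (N k : ℝ))) * e
    · simp
  rw [penalty, Finset.sum_congr rfl hsplit, Finset.sum_add_distrib, Finset.sum_sub_distrib,
    Finset.sum_ite_eq', Finset.sum_ite_eq', penalty, gain, gain]
  simp only [Finset.mem_Icc]
  split_ifs <;> ring

lemma penalty_nonneg (hε : 0 < ε) : 0 ≤ penalty B ε N := by
  unfold penalty; positivity

lemma penalty_le (hε : 0 < ε) : penalty B ε N ≤ (B : ℝ) ^ 2 / ε := by
  have h1 : ∑ k ∈ Finset.Icc 1 (B - 1), Real.exp (-ε * (N k : ℝ)) ≤ B := by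
    calc _ ≤ ∑ k ∈ Finset.Icc 1 (B - 1), (1 : ℝ) := by
          refine Finset.sum_le_sum fun k _ => Real.exp_le_one_iff.2 ?_
          have : 0 ≤ ε * (N k : ℝ) := by positivity
          linarith
      _ ≤ B := by simp
  calc penalty B ε N ≤ (B : ℝ) / ε * B := by unfold penalty; gcongr
    _ = _ := by ring

lemma objective_eq (B : ℕ) (ε : ℝ) (N : ℕ → ℕ) (s h : ℕ) :
    objective B ε N s h
      = (if h = 0 then (B : ℝ) else 0) - (s : ℝ) + penalty B ε (place B N s h) := rfl

lemma neg_le_objective (hε : 0 < ε) : -(s : ℝ) ≤ objective B ε N s h := by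
  rw [objective_eq]
  have := penalty_nonneg (B := B) (N := place B N s h) hε
  split_ifs
  · have : (0 : ℝ) ≤ B := B.cast_nonneg
    linarith
  · linarith

lemma bddBelow_objective (hε : 0 < ε) :
    BddBelow (objective B ε N s '' {h | Feasible B N s h}) :=
  ⟨-(s : ℝ), by rintro _ ⟨h, -, rfl⟩; exact neg_le_objective hε⟩

lemma feasible_zero (hs : s ≤ B) : Feasible B N s 0 := ⟨by omega, Or.inl rfl⟩

lemma minIncrease_le (hε : 0 < ε) (hf : Feasible B N s h) :
    minIncrease B ε N s ≤ objective B ε N s h - penalty B ε N :=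
  sub_le_sub_right (csInf_le (bddBelow_objective hε) ⟨h, hf, rfl⟩) _

lemma abs_minIncrease_le (hε : 0 < ε) (hs : s ≤ B) :
    |minIncrease B ε N s| ≤ B + (B : ℝ) ^ 2 / ε := by
  have hs' : (s : ℝ) ≤ B := by exact_mod_cast hs
  have h0 : (0 : ℝ) ≤ s := s.cast_nonneg
  rw [abs_le]
  constructor
  · have h1 : -(s : ℝ) ≤ sInf (objective B ε N s '' {h | Feasible B N s h}) :=
      le_csInf ⟨_, 0, feasible_zero hs, rfl⟩
        (by rintro _ ⟨h, -, rfl⟩; exact neg_le_objective hε)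
    have h2 := penalty_le (B := B) (N := N) hε
    rw [minIncrease]
    linarith
  · have h1 := minIncrease_le hε (feasible_zero (N := N) hs)
    have h2 := penalty_le (B := B) (N := place B N s 0) hε
    have h3 := penalty_nonneg (B := B) (N := N) hε
    rw [objective_eq, if_pos rfl] at h1
    linarith

/-- A step of the algorithm raises the potential by the least possible amount. -/
lemma potential_of_step (hε : 0 < ε) (hs : 0 < s) {N' : ℕ → ℕ} (hstep : PDExpStep B ε s N N') :
    potential B ε N' = potential B ε N + minIncrease B ε N s := by
  obtain ⟨h, hf, hmin, rfl⟩ := hstep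
  have : sInf (objective B ε N s '' {h | Feasible B N s h}) = objective B ε N s h :=
    le_antisymm (csInf_le (bddBelow_objective hε) ⟨h, hf, rfl⟩)
      (le_csInf ⟨_, h, hf, rfl⟩ (by rintro _ ⟨h', hf', rfl⟩; exact hmin h' hf'))
  rw [minIncrease, this, objective_eq, potential, potential, waste_place hs hf]
  ring

lemma gain_nonneg (hε : 0 < ε) (k : ℕ) : 0 ≤ gain B ε N k := by
  have : Real.exp (-ε) ≤ 1 := Real.exp_le_one_iff.2 (by linarith)
  have : 0 ≤ 1 - Real.exp (-ε) := by linarith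
  unfold gain
  split_ifs <;> positivity

/-! ### Comparison with an offline packing -/

/-- The left side is the increase of the penalty when a bin of level `h` is taken away; it exceeds
the gain of adding one by at most `B * ε`: the second difference of the penalty is
`B / ε * (1 - exp (-ε)) ^ 2` at count `1` and smaller at larger counts. -/
lemma exp_mul_gain_le (hε : 0 < ε) (hN : 0 < N h) :
    Real.exp ε * gain B ε N h ≤ gain B ε N h + B * ε := by
  have e : Real.exp ε * Real.exp (-ε) = 1 := by rw [← Real.exp_add]; simp
  have e1 : 1 - ε ≤ Real.exp (-ε) := by linarith [Real.add_one_le_exp (-ε)]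
  have e2 : Real.exp (-ε) ≤ 1 := Real.exp_le_one_iff.2 (by linarith)
  unfold gain
  split_ifs
  · have hexp : Real.exp (-ε * (N h : ℝ)) ≤ Real.exp (-ε) := by
      have : (1 : ℝ) ≤ N h := by exact_mod_cast hN
      apply Real.exp_le_exp.2
      nlinarith
    have e3 : 0 ≤ Real.exp ε - 1 := by linarith [Real.add_one_le_exp ε]
    have hsq : (1 - Real.exp (-ε)) ^ 2 ≤ ε ^ 2 := by
      apply pow_le_pow_left₀ <;> linarith
    have : Real.exp (-ε * (N h : ℝ)) * ((Real.exp ε - 1) * (1 - Real.exp (-ε))) ≤ ε ^ 2 := by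
      calc _ ≤ Real.exp (-ε) * ((Real.exp ε - 1) * (1 - Real.exp (-ε))) := by
            apply mul_le_mul_of_nonneg_right hexp
            exact mul_nonneg e3 (by linarith)
        _ = (1 - Real.exp (-ε)) ^ 2 := by linear_combination (1 - Real.exp (-ε)) * e
        _ ≤ ε ^ 2 := hsq
    have h2 := mul_le_mul_of_nonneg_left this (show 0 ≤ (B : ℝ) / ε by positivity)
    have h3 : (B : ℝ) / ε * ε ^ 2 = B * ε := by field_simp
    linarith
  · have : 0 ≤ (B : ℝ) * ε := by positivity
    linarith

/-- At a level without bins the gain is almost the cost `B` of a new bin. -/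
lemma le_gain_of_eq_zero (hε : 0 < ε) (h1 : 1 ≤ h) (h2 : h ≤ B - 1) (hN : N h = 0) :
    (B : ℝ) ≤ gain B ε N h + B * ε := by
  rw [gain, if_pos ⟨h1, h2⟩, hN]
  have e : Real.exp ε * Real.exp (-ε) = 1 := by rw [← Real.exp_add]; simp
  have e1 : ε * (1 - ε) ≤ 1 - Real.exp (-ε) := by
    have := Real.add_one_le_exp ε
    have := Real.exp_pos (-ε)
    nlinarith [mul_nonneg hε.le hε.le]
  have h2 := mul_le_mul_of_nonneg_left e1 (show 0 ≤ (B : ℝ) / ε by positivity)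
  have h3 : (B : ℝ) / ε * (ε * (1 - ε)) = B - B * ε := by field_simp
  simp only [Nat.cast_zero, mul_zero, Real.exp_zero, one_mul]
  linarith

lemma minIncrease_le_of_new (hε : 0 < ε) (hs : 0 < s) (hsB : s ≤ B) :
    minIncrease B ε N s ≤ B - s - gain B ε N s := by
  have h1 := minIncrease_le hε (feasible_zero (N := N) hsB)
  rw [objective_eq, penalty_place hs (feasible_zero hsB), if_pos rfl, zero_add] at h1
  have : gain B ε N 0 = 0 := by simp [gain]
  rw [this] at h1
  linarith

lemma minIncrease_le_of_pos (hε : 0 < ε) (hs : 0 < s) (hsB : h + s ≤ B) (h0 : h ≠ 0)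
    (hN : 0 < N h) :
    minIncrease B ε N s ≤ gain B ε N h - s - gain B ε N (h + s) + B * ε := by
  have hf : Feasible B N s h := ⟨hsB, Or.inr hN⟩
  have h1 := minIncrease_le hε hf
  rw [objective_eq, penalty_place hs hf, if_neg h0] at h1
  have := exp_mul_gain_le (B := B) hε hN
  linarith

/-- The items of `S` are imagined as put one after the other on top of a bin of level `h`. Where the
current level has no bin, the item opens a new bin instead and the remaining items follow it there.
This detour is paid for by the gain at the empty level, which is `B` up to `B * ε`; the bound
holds for arbitrary `N` for this reason. -/
lemma sum_minIncrease_le {ι : Type*} (hε : 0 < ε) (a : ι → ℕ) (ha : ∀ i, 0 < a i)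
    (S : Finset ι) : ∀ h : ℕ, h + ∑ i ∈ S, a i ≤ B →
      ∑ i ∈ S, minIncrease B ε N (a i)
        ≤ (if h = 0 then (B : ℝ) else gain B ε N h) - ∑ i ∈ S, (a i : ℝ) + S.card * (B * ε) := by
  classical
  induction S using Finset.induction_on with
  | empty =>
    intro h _
    simp only [Finset.sum_empty, Finset.card_empty, Nat.cast_zero, zero_mul, sub_zero, add_zero]
    split_ifs
    · positivity
    · exact gain_nonneg hε h
  | insert i S hi ih =>
    intro h hB
    rw [Finset.sum_insert hi] at hB
    rw [Finset.sum_insert hi, Finset.sum_insert hi, Finset.card_insert_of_notMem hi]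
    have hai := ha i
    have hBε : 0 ≤ (B : ℝ) * ε := by positivity
    push_cast
    by_cases hnew : h = 0 ∨ N h = 0
    · have h1 := minIncrease_le_of_new (N := N) hε hai (show a i ≤ B by omega)
      have h2 := ih (a i) (by omega)
      rw [if_neg hai.ne'] at h2
      have h3 : (B : ℝ) ≤ (if h = 0 then (B : ℝ) else gain B ε N h) + B * ε := by
        split_ifs with h0
        · linarith
        · exact le_gain_of_eq_zero hε (by omega) (by omega) (hnew.resolve_left h0)
      linarith
    · push Not at hnew
      have h1 := minIncrease_le_of_pos (N := N) hε hai (show h + a i ≤ B by omega) hnew.1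
        (Nat.pos_of_ne_zero hnew.2)
      have h2 := ih (h + a i) (by omega)
      rw [if_neg (by omega)] at h2
      rw [if_neg hnew.1]
      linarith

lemma waste_levelCount {n : ℕ} {a f : Fin n → ℕ} (ha : ∀ i, 0 < a i) (hf : IsPacking B a f) :
    (waste B (levelCount a f) : ℝ)
      = ∑ b ∈ Finset.univ.image f, ((B : ℝ) - binLevel a f b) := by
  have hpos : ∀ b ∈ Finset.univ.image f, 1 ≤ binLevel a f b := by
    intro b hb
    obtain ⟨i, -, rfl⟩ := Finset.mem_image.1 hb
    exact (ha i).trans_le (Finset.single_le_sum (f := a) (fun _ _ => Nat.zero_le _)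
      (Finset.mem_filter.2 ⟨Finset.mem_univ i, rfl⟩))
  have hmaps : ∀ b ∈ Finset.univ.image f, binLevel a f b ∈ Finset.Icc 1 B := fun b hb =>
    Finset.mem_Icc.2 ⟨hpos b hb, hf b⟩
  have hsub : Finset.Icc 1 (B - 1) ⊆ Finset.Icc 1 B := Finset.Icc_subset_Icc_right (by omega)
  rw [← Finset.sum_fiberwise_of_maps_to hmaps, waste, Nat.cast_sum,
    ← Finset.sum_subset hsub]
  · refine Finset.sum_congr rfl fun k hk => ?_
    rw [Finset.mem_Icc] at hk
    rw [Finset.sum_congr rfl (g := fun _ => (B : ℝ) - k)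
      (fun b hb => by rw [(Finset.mem_filter.1 hb).2]), Finset.sum_const, nsmul_eq_mul,
      Nat.cast_mul, Nat.cast_sub (by omega), levelCount]
  · intro k hk hk'
    rw [Finset.mem_Icc] at hk hk'
    have hkB : k = B := by omega
    refine Finset.sum_eq_zero fun b hb => ?_
    rw [(Finset.mem_filter.1 hb).2, hkB, sub_self]

/-- In every state, the least potential increases of the items of a list sum to at most the optimal
offline waste of the list, up to `B * ε` per item. -/
lemma sum_minIncrease_le_optWaste {n : ℕ} (hε : 0 < ε) (a : Fin n → ℕ) (ha : ∀ i, 0 < a i)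
    (haB : ∀ i, a i ≤ B) :
    ∑ i, minIncrease B ε N (a i) ≤ optWaste B a + n * (B * ε) := by
  have hne : {w | ∃ f : Fin n → ℕ, IsPacking B a f ∧ w = waste B (levelCount a f)}.Nonempty := by
    refine ⟨_, fun i => (i : ℕ), fun b => ?_, rfl⟩
    rw [binLevel]
    by_cases hb : ∃ i : Fin n, (i : ℕ) = b
    · obtain ⟨i, rfl⟩ := hb
      have : Finset.univ.filter (fun j : Fin n => (j : ℕ) = i) = {i} := by
        ext j; simp [Fin.ext_iff]
      rw [this, Finset.sum_singleton]
      exact haB i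
    · rw [Finset.filter_eq_empty_iff.2 (fun i _ hi => hb ⟨i, hi⟩)]
      simp
  obtain ⟨f, hf, hw⟩ := Nat.sInf_mem hne
  rw [← optWaste] at hw
  have hmaps : ∀ i ∈ (Finset.univ : Finset (Fin n)), f i ∈ Finset.univ.image f :=
    fun i hi => Finset.mem_image_of_mem f hi
  have hcard : (n : ℝ) = ∑ b ∈ Finset.univ.image f,
      ((Finset.univ.filter (fun i => f i = b)).card : ℝ) := by
    have := Finset.card_eq_sum_card_fiberwise hmaps
    rw [Finset.card_univ, Fintype.card_fin] at this
    exact_mod_cast this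
  rw [hw, waste_levelCount ha hf, hcard, Finset.sum_mul, ← Finset.sum_add_distrib,
    ← Finset.sum_fiberwise_of_maps_to hmaps]
  refine Finset.sum_le_sum fun b _ => ?_
  have := sum_minIncrease_le (N := N) (B := B) hε a ha (Finset.univ.filter (fun i => f i = b)) 0
    (by rw [zero_add]; exact hf b)
  rw [if_pos rfl] at this
  rw [binLevel, Nat.cast_sum]
  exact this

end Deterministic

/-! ### Measurability and the expected potential -/

lemma minIncrease_congr {B : ℕ} {ε : ℝ} {s : ℕ} (hs : 0 < s) {N M : ℕ → ℕ}
    (h : ∀ k ∈ Finset.Icc 1 (B - 1), N k = M k) :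
    minIncrease B ε N s = minIncrease B ε M s := by
  have hplace : ∀ l, place B N s l = place B M s l := by
    intro l
    funext k
    unfold place
    split_ifs with hk <;> first | rfl | rw [h k (Finset.mem_Icc.2 hk)]
  have hfeas : ∀ l, Feasible B N s l ↔ Feasible B M s l := by
    intro l
    unfold Feasible
    refine and_congr_right fun hl => ?_
    rcases Nat.eq_zero_or_pos l with h0 | h0
    · simp [h0]
    · rw [h l (Finset.mem_Icc.2 ⟨h0, by omega⟩)]
  have hobj : objective B ε N s = objective B ε M s := by
    funext l
    rw [objective_eq, objective_eq, hplace]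
  have hpen : penalty B ε N = penalty B ε M := by
    unfold penalty
    rw [Finset.sum_congr rfl fun k hk => by rw [h k hk]]
  simp only [minIncrease, hobj, hpen, hfeas]

/-- A function of the state that depends only on finitely many coordinates factors through a
countable discrete space, hence preserves measurability. -/
lemma measurable_comp_of_local {Ω : Type*} {m : MeasurableSpace Ω} {N : Ω → ℕ → ℕ}
    (hN : ∀ k, Measurable (fun ω => N ω k)) (S : Finset ℕ) {g : (ℕ → ℕ) → ℝ}
    (hg : ∀ M M' : ℕ → ℕ, (∀ k ∈ S, M k = M' k) → g M = g M') :
    Measurable (fun ω => g (N ω)) := by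
  have h1 : Measurable (fun (ω : Ω) (k : S) => N ω k) := measurable_pi_lambda _ fun k => hN k
  have h2 : Measurable (fun v : S → ℕ => g fun k => if h : k ∈ S then v ⟨k, h⟩ else 0) :=
    Measurable.of_discrete
  have h3 : (fun ω => g (N ω)) = (fun v : S → ℕ => g fun k => if h : k ∈ S then v ⟨k, h⟩ else 0) ∘
      (fun (ω : Ω) (k : S) => N ω k) := by
    funext ω
    exact hg _ _ fun k hk => by simp [hk]
  rw [h3]
  exact h2.comp h1

variable {Ω : Type*} [mΩ : MeasurableSpace Ω] {P : Measure Ω}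
  {ℱ : Filtration ℕ mΩ} {B J n : ℕ} {ε : ℝ} {s : Fin J → ℕ} {p : Fin J → ℝ}
  {X : ℕ → Ω → Fin J} {N : ℕ → Ω → ℕ → ℕ}

lemma IsIIDArrivals.measurable_arrival (hX : IsIIDArrivals P ℱ p n X) {t : ℕ} (ht : t < n) :
    Measurable (X t) :=
  (hX.measurable t ht).mono (ℱ.le _) le_rfl

lemma IsIIDArrivals.measurable_optWaste (hX : IsIIDArrivals P ℱ p n X) :
    Measurable (fun ω => (optWaste B (fun i : Fin n => s (X i ω)) : ℝ)) := by
  have h1 : Measurable (fun (ω : Ω) (i : Fin n) => X i ω) :=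
    measurable_pi_lambda _ fun i => hX.measurable_arrival i.2
  exact (Measurable.of_discrete
    (f := fun x : Fin n → Fin J => (optWaste B (fun i => s (x i)) : ℝ))).comp h1

lemma IsPDExp.measurable_minIncrease (hpos : ∀ j, 0 < s j) (hN : IsPDExp P ℱ B ε s n X N)
    {t : ℕ} (ht : t ≤ n) (j : Fin J) :
    Measurable[ℱ t] (fun ω => minIncrease B ε (N t ω) (s j)) :=
  measurable_comp_of_local (m := ℱ t) (hN.adapted t ht) _ (g := fun M => minIncrease B ε M (s j))
    fun _ _ h => minIncrease_congr (hpos j) h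

lemma IsPDExp.measurable_waste (hN : IsPDExp P ℱ B ε s n X N) {t : ℕ} (ht : t ≤ n) :
    Measurable (fun ω => (waste B (N t ω) : ℝ)) :=
  measurable_comp_of_local (fun k => (hN.adapted t ht k).mono (ℱ.le t) le_rfl) _
    (g := fun M => (waste B M : ℝ)) fun _ _ h => by
      unfold waste
      rw [Finset.sum_congr rfl fun k hk => by rw [h k hk]]

variable [IsProbabilityMeasure P]

lemma IsIIDArrivals.integral_comp (hX : IsIIDArrivals P ℱ p n X) {t : ℕ} (ht : t < n)
    (g : Fin J → ℝ) : ∫ ω, g (X t ω) ∂P = ∑ j, p j * g j := by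
  have hm := hX.measurable_arrival ht
  rw [← integral_map (φ := X t) hm.aemeasurable
    (Measurable.of_discrete (f := g)).aestronglyMeasurable]
  have := Measure.isProbabilityMeasure_map (μ := P) hm.aemeasurable
  rw [integral_fintype Integrable.of_finite]
  refine Finset.sum_congr rfl fun j _ => ?_
  rw [map_measureReal_apply hm (MeasurableSet.singleton j), smul_eq_mul]
  congr 1
  exact hX.law t ht j

lemma IsIIDArrivals.integrable_optWaste (hX : IsIIDArrivals P ℱ p n X) :
    Integrable (fun ω => (optWaste B (fun i : Fin n => s (X i ω)) : ℝ)) P := by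
  obtain ⟨C, hC⟩ := (Set.finite_range
    (fun x : Fin n → Fin J => (optWaste B (fun i => s (x i)) : ℝ))).bddAbove
  refine Integrable.of_bound hX.measurable_optWaste.aestronglyMeasurable C (ae_of_all _ fun ω => ?_)
  rw [Real.norm_of_nonneg (Nat.cast_nonneg _)]
  exact hC ⟨fun i => X i ω, rfl⟩

/-- In every fixed state, the expected least increase of the potential is at most the optimal
expected waste per item plus `B * ε`. -/
lemma expected_minIncrease_le (hε : 0 < ε) (hpos : ∀ j, 0 < s j) (hlt : ∀ j, s j < B)
    (hX : IsIIDArrivals P ℱ p n X) (M : ℕ → ℕ) :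
    n * ∑ j, p j * minIncrease B ε M (s j)
      ≤ ∫ ω, (optWaste B (fun i : Fin n => s (X i ω)) : ℝ) ∂P + n * (B * ε) := by
  have hint : ∀ i : Fin n, Integrable (fun ω => minIncrease B ε M (s (X i ω))) P := fun i =>
    Integrable.of_bound ((Measurable.of_discrete (f := fun j => minIncrease B ε M (s j))).comp
      (hX.measurable_arrival i.2)).aestronglyMeasurable _
      (ae_of_all _ fun ω => abs_minIncrease_le hε (hlt _).le)
  have h1 : ∫ ω, ∑ i : Fin n, minIncrease B ε M (s (X i ω)) ∂P
      = n * ∑ j, p j * minIncrease B ε M (s j) := by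
    rw [integral_finsetSum _ fun i _ => hint i,
      Finset.sum_congr rfl fun i _ => hX.integral_comp i.2 fun j => minIncrease B ε M (s j)]
    simp
  have h2 : ∫ ω, ((optWaste B (fun i : Fin n => s (X i ω)) : ℝ) + n * (B * ε)) ∂P
      = ∫ ω, (optWaste B (fun i : Fin n => s (X i ω)) : ℝ) ∂P + n * (B * ε) := by
    rw [integral_add hX.integrable_optWaste (integrable_const _)]
    simp
  rw [← h1, ← h2]
  exact integral_mono (integrable_finsetSum _ fun i _ => hint i)
    (hX.integrable_optWaste.add (integrable_const _)) fun ω =>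
      sum_minIncrease_le_optWaste hε _ (fun i => hpos _) (fun i => (hlt _).le)

/-- The arriving item is independent of the current state, so in expectation its type can be
averaged out with the state held fixed. -/
lemma integral_minIncrease_arrival (hε : 0 < ε) (hpos : ∀ j, 0 < s j) (hlt : ∀ j, s j < B)
    (hX : IsIIDArrivals P ℱ p n X) (hN : IsPDExp P ℱ B ε s n X N) {t : ℕ} (ht : t < n) :
    Integrable (fun ω => minIncrease B ε (N t ω) (s (X t ω))) P ∧
    ∫ ω, minIncrease B ε (N t ω) (s (X t ω)) ∂P
      = ∫ ω, ∑ j, p j * minIncrease B ε (N t ω) (s j) ∂P := by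
  have hXm := hX.measurable_arrival ht
  have hcm : ∀ j, Measurable (fun ω => minIncrease B ε (N t ω) (s j)) := fun j =>
    (hN.measurable_minIncrease hpos ht.le j).mono (ℱ.le t) le_rfl
  have hci : ∀ j, Integrable (fun ω => minIncrease B ε (N t ω) (s j)) P := fun j =>
    Integrable.of_bound (hcm j).aestronglyMeasurable _
      (ae_of_all _ fun ω => abs_minIncrease_le hε (hlt _).le)
  let ind : Fin J → Fin J → ℝ := fun j x => if x = j then 1 else 0
  have hindm : ∀ j, Measurable (fun ω => ind j (X t ω)) := fun j =>
    (Measurable.of_discrete (f := ind j)).comp hXm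
  have hsplit : ∀ ω, minIncrease B ε (N t ω) (s (X t ω))
      = ∑ j, ind j (X t ω) * minIncrease B ε (N t ω) (s j) := fun ω => by simp [ind]
  have hprodi : ∀ j, Integrable
      (fun ω => ind j (X t ω) * minIncrease B ε (N t ω) (s j)) P := fun j => by
    refine (hci j).bdd_mul (c := 1) (hindm j).aestronglyMeasurable (ae_of_all _ fun ω => ?_)
    simp only [ind]
    split_ifs <;> simp
  have hprod : ∀ j, ∫ ω, ind j (X t ω) * minIncrease B ε (N t ω) (s j) ∂P
      = p j * ∫ ω, minIncrease B ε (N t ω) (s j) ∂P := by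
    intro j
    have hind : IndepFun (X t) (fun ω => minIncrease B ε (N t ω) (s j)) P := by
      rw [IndepFun_iff_Indep]
      exact indep_of_indep_of_le_right (hX.indep t ht)
        (hN.measurable_minIncrease hpos ht.le j).comap_le
    have h2 : IndepFun (fun ω => ind j (X t ω)) (fun ω => minIncrease B ε (N t ω) (s j)) P :=
      hind.comp (φ := ind j) (ψ := id) Measurable.of_discrete measurable_id
    rw [h2.integral_fun_mul_eq_mul_integral (hindm j).aestronglyMeasurable
      (hcm j).aestronglyMeasurable, hX.integral_comp ht (ind j)]
    simp [ind]
  simp only [hsplit]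
  refine ⟨integrable_finsetSum _ fun j _ => hprodi j, ?_⟩
  rw [integral_finsetSum _ fun j _ => hprodi j,
    integral_finsetSum _ fun j _ => (hci j).const_mul _]
  refine Finset.sum_congr rfl fun j _ => ?_
  rw [hprod, integral_const_mul]

/-- The expected potential grows by at most the optimal expected waste per item plus `B * ε` in
each step. -/
lemma integral_potential_le (hε : 0 < ε) (hpos : ∀ j, 0 < s j) (hlt : ∀ j, s j < B) (hn : 0 < n)
    (hX : IsIIDArrivals P ℱ p n X) (hN : IsPDExp P ℱ B ε s n X N) :
    ∀ t ≤ n, Integrable (fun ω => potential B ε (N t ω)) P ∧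
      ∫ ω, potential B ε (N t ω) ∂P ≤ (B : ℝ) ^ 2 / ε
        + t * ((∫ ω, (optWaste B (fun i : Fin n => s (X i ω)) : ℝ) ∂P) / n + B * ε) := by
  intro t
  induction t with
  | zero =>
    intro _
    have h0 : (fun ω => potential B ε (N 0 ω)) =ᵐ[P] fun _ => potential B ε fun _ => 0 := by
      filter_upwards [hN.init] with ω hω
      rw [show N 0 ω = fun _ => 0 from funext hω]
    refine ⟨(integrable_const _).congr h0.symm, ?_⟩
    rw [integral_congr_ae h0]
    have := penalty_le (B := B) (N := fun _ => 0) hε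
    simpa [potential, waste] using this
  | succ t ih =>
    intro ht
    obtain ⟨hi, hle⟩ := ih (by omega)
    have hstep : (fun ω => potential B ε (N (t + 1) ω)) =ᵐ[P] fun ω => potential B ε (N t ω)
        + minIncrease B ε (N t ω) (s (X t ω)) := by
      filter_upwards [hN.step] with ω hω
      exact potential_of_step hε (hpos _) (hω t (by omega))
    obtain ⟨hci, hce⟩ := integral_minIncrease_arrival hε hpos hlt hX hN (show t < n by omega)
    refine ⟨(hi.add hci).congr hstep.symm, ?_⟩
    rw [integral_congr_ae hstep, integral_add hi hci, hce]
    have hn' : (0 : ℝ) < n := by exact_mod_cast hn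
    have hdrift : ∫ ω, ∑ j, p j * minIncrease B ε (N t ω) (s j) ∂P
        ≤ (∫ ω, (optWaste B (fun i : Fin n => s (X i ω)) : ℝ) ∂P) / n + B * ε := by
      have hsum : Integrable (fun ω => ∑ j, p j * minIncrease B ε (N t ω) (s j)) P :=
        integrable_finsetSum _ fun j _ => (Integrable.of_bound
          ((hN.measurable_minIncrease hpos (by omega) j).mono (ℱ.le t) le_rfl).aestronglyMeasurable
          _ (ae_of_all _ fun ω => abs_minIncrease_le hε (hlt _).le)).const_mul _
      refine (integral_mono hsum (integrable_const _) fun ω => ?_).trans_eq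
        ((integral_const _).trans (by rw [probReal_univ, one_smul]))
      have := expected_minIncrease_le hε hpos hlt hX (N t ω)
      beta_reduce
      rw [← sub_le_iff_le_add, le_div_iff₀ hn']
      linarith
    push_cast
    linarith

end BinPacking
end

theorem theorem3 {Ω : Type*} [mΩ : MeasurableSpace Ω] (P : Measure Ω) [IsProbabilityMeasure P]
    (B J : ℕ) (s : Fin J → ℕ) (hs_mono : StrictMono s) (hs_pos : ∀ j, 0 < s j)
    (hs_lt : ∀ j, s j < B)
    (p : Fin J → ℝ) (hp_nonneg : ∀ j, 0 ≤ p j) (hp_sum : ∑ j, p j = 1)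
    (n : ℕ) (hn : B < n)
    (ℱ : Filtration ℕ mΩ) (X : ℕ → Ω → Fin J) (hX : BinPacking.IsIIDArrivals P ℱ p n X)
    (N : ℕ → Ω → ℕ → ℕ)
    (hN : BinPacking.IsPDExp P ℱ B (Real.sqrt ((B : ℝ) / (n : ℝ))) s n X N) :
    Integrable (fun ω => (BinPacking.waste B (N n ω) : ℝ)) P ∧
    Integrable (fun ω => (BinPacking.optWaste B (fun i : Fin n => s (X i ω)) : ℝ)) P ∧
    ∫ ω, (BinPacking.waste B (N n ω) : ℝ) ∂P
      ≤ ∫ ω, (BinPacking.optWaste B (fun i : Fin n => s (X i ω)) : ℝ) ∂P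
        + Real.sqrt (4 * (B : ℝ) ^ 3 * (n : ℝ)) := by
  have hB : (0 : ℝ) < B := by
    have hJ : J ≠ 0 := by
      rintro rfl
      simp at hp_sum
    exact_mod_cast (Nat.zero_le _).trans_lt (hs_lt ⟨0, Nat.pos_of_ne_zero hJ⟩)
  have hn0 : 0 < n := by omega
  have hn' : (0 : ℝ) < n := by exact_mod_cast hn0
  set ε := Real.sqrt ((B : ℝ) / (n : ℝ)) with hεdef
  have hε : 0 < ε := Real.sqrt_pos.2 (by positivity)
  obtain ⟨hVi, hV⟩ := BinPacking.integral_potential_le hε hs_pos hs_lt hn0 hX hN n le_rfl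
  have hle : ∀ ω, (BinPacking.waste B (N n ω) : ℝ) ≤ BinPacking.potential B ε (N n ω) := fun ω =>
    le_add_of_nonneg_right (BinPacking.penalty_nonneg hε)
  have hWi : Integrable (fun ω => (BinPacking.waste B (N n ω) : ℝ)) P := by
    refine hVi.mono' (hN.measurable_waste le_rfl).aestronglyMeasurable (ae_of_all _ fun ω => ?_)
    rw [Real.norm_of_nonneg (Nat.cast_nonneg _)]
    exact hle ω
  refine ⟨hWi, hX.integrable_optWaste, (integral_mono hWi hVi hle).trans (hV.trans_eq ?_)⟩
  -- The choice of `ε` makes the initial penalty `B ^ 2 / ε` and the total drift error `n * B * ε`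
  -- equal.
  have hsq : ε ^ 2 = B / n := Real.sq_sqrt (by positivity)
  have hBn : (B : ℝ) = n * ε ^ 2 := by rw [hsq]; field_simp
  have h1 : (B : ℝ) ^ 2 / ε = n * (B * ε) := by
    rw [div_eq_iff hε.ne']
    linear_combination (B : ℝ) * hBn
  have h2 : Real.sqrt (4 * (B : ℝ) ^ 3 * (n : ℝ)) = 2 * (n * (B * ε)) := by
    rw [Real.sqrt_eq_iff_mul_self_eq (by positivity) (by positivity)]
    linear_combination (4 * (n : ℝ) * B ^ 2) * hBn
  rw [h1, h2, mul_add, mul_div_cancel₀ _ hn'.ne']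
  ring
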